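/- Let $\alpha>0$, let $c_1,c_{-1}\ge 0$ be constants, and let $\nu^\alpha$ be the measure on $(0,\infty)$ given by $\nu^\alpha(dx)=\alpha x^{-(\alpha+1)}\,dx$. For $\sigma$-finite Borel measures $\nu,\rho$ on $\mathbb R$ let $\nu\circledast\rho$ be their multiplicative convolution, $(\nu\circledast\rho)(B)=\int \nu(\{y: xy\in B\})\,\rho(dx)$ for Borel sets $B$. Let $\rho_1,\rho_{-1}$ be $\sigma$-finite measures on $(0,\infty)$ with $$\|\rho_i\|_\alpha^\alpha:=\int_0^\infty x^\alpha\,\rho_i(dx)<\infty,\qquad i=\pm1,$$ and let $\nu_1^{(1)},\nu_{-1}^{(1)}$ be $\sigma$-finite measures on $[0,\infty)$ satisfying the two equations $$\nu_1^{(1)}\circledast\rho_i+\nu_{-1}^{(1)}\circledast\rho_{-i}=\bigl(c_1\|\rho_i\|_\alpha^\alpha+c_{-1}\|\rho_{-i}\|_\alpha^\alpha\bigr)\,\nu^\alpha,\qquad i=\pm1.$$ Suppose that for every $\theta\in\mathbb R$ both $$\int_0^\infty x^{\alpha+i\theta}\,\rho_1(dx)+\int_0^\infty x^{\alpha+i\theta}\,\rho_{-1}(dx)\neq0\quad\text{and}\quad\int_0^\infty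 x^{\alpha+i\theta}\,\rho_1(dx)-\int_0^\infty x^{\alpha+i\theta}\,\rho_{-1}(dx)\neq0,$$ where in the exponents $i$ denotes the imaginary unit. Then $\nu_i^{(1)}=c_i\,\nu^\alpha$ for $i=\pm1$. -/

import Mathlib

open MeasureTheory Set
open scoped NNReal ENNReal

/- The multiplicative convolution `ν ⊛ ρ` on `ℝ` is Mathlib's `Measure.mconv ν ρ`. The next lemma
checks that, for σ-finite measures, it is given on Borel sets by
`(ν ⊛ ρ)(B) = ∫ ν (T_x⁻¹ B) ρ(dx)`, where `T_x y = x * y`. -/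
theorem mconv_apply_eq_lintegral_dilation (ν ρ : Measure ℝ) [SigmaFinite ν] [SigmaFinite ρ]
    {B : Set ℝ} (hB : MeasurableSet B) :
    (Measure.mconv ν ρ) B = ∫⁻ x, ν ((fun y : ℝ => x * y) ⁻¹' B) ∂ρ := by
  rw [Measure.mconv_comm, Measure.mconv, Measure.map_apply (by fun_prop) hB,
    Measure.prod_apply (measurableSet_preimage (by fun_prop) hB)]
  rfl

/-- The measure `ν^α(dx) = α x^{-(α+1)} dx` on `(0,∞)`, as a Borel measure on `ℝ`. -/
noncomputable def powerTail (α : ℝ) : Measure ℝ :=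
  (volume.restrict (Ioi 0)).withDensity fun x => ENNReal.ofReal (α * x ^ (-(α + 1)))

/-- The moment `‖ρ‖_α^α = ∫_{(0,∞)} x^α ρ(dx) ∈ [0,∞]`. -/
noncomputable def absMoment (α : ℝ) (ρ : Measure ℝ) : ℝ≥0∞ :=
  ∫⁻ x in Ioi (0 : ℝ), ENNReal.ofReal (x ^ α) ∂ρ

/-- The complex moment `∫_{(0,∞)} x^{α + iθ} ρ(dx)`. -/
noncomputable def complexMoment (α θ : ℝ) (ρ : Measure ℝ) : ℂ :=
  ∫ x in Ioi (0 : ℝ), (x : ℂ) ^ ((α : ℂ) + θ * Complex.I) ∂ρ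

open Filter Topology FourierTransform SchwartzMap

/-! Test the two equations against `φ (p * ·)`, with `φ` a continuous cutoff, and put N_i(p) = ∫
φ(py) ν_i(dy). Adding s = ±1 times one equation to the other decouples the system: N_1 + s N_{-1},
convolved multiplicatively with ρ_1 + s ρ_{-1}, is a multiple of p^α. After p = e^u, division by
e^{αu} and subtraction of the expected constant, this says that a function D on the line is
annihilated by convolution with the image under log of x^α (ρ_1 + s ρ_{-1}), a finite signed
measure. Its Fourier transform is the sum or difference of the complex moments, which never
vanishes. D is continuous, and bounded because the equations force tails of order p^{-α} on each ν_i
(`exists_hasTailBound_of_mconv_le`). Wiener's theorem gives D = 0. The two signs determine N_1 and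
N_{-1}, and cutoffs tending to the indicator of [1, ∞) recover the tails of ν_i, hence ν_i.

Wiener's theorem (`eq_zero_of_forall_integral_add_mul_eq_zero`) is proved for bounded continuous g.
A narrow low-pass filter of g hardly varies on the scale of Y, so the convolution nearly multiplies
it by ∫ h ≠ 0; being annihilated, it must vanish (`integral_mul_eq_zero_of_small`). Modulation
carries this to every frequency in a compact range, and superposing these frequencies removes every
band-limited average of g. -/

/-! ### Low-pass kernels and L¹ continuity of translations -/

/-- The bump `b₂` is 1 on the support of the bump `b`, so `b * b₂ = b`; transforming gives the
reproducing identity with `k = 𝓕⁻ b₂`. Since `b` is even, `𝓕 b = 𝓕⁻ b`. -/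
theorem exists_schwartz_reproducing :
    ∃ b k : 𝓢(ℝ, ℂ), HasCompactSupport b ∧ b 0 ≠ 0 ∧ 𝓕 b 0 ≠ 0 ∧
      ∀ x, ∫ z, 𝓕 b (x - z) * k z = 𝓕 b x := by
  let β₁ : ContDiffBump (0 : ℝ) := ⟨1, 2, one_pos, one_lt_two⟩
  let β₂ : ContDiffBump (0 : ℝ) := ⟨2, 3, two_pos, by norm_num⟩
  have hc (β : ContDiffBump (0 : ℝ)) : HasCompactSupport fun x => (β x : ℂ) :=
    β.hasCompactSupport.comp_left Complex.ofReal_zero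
  have hd (β : ContDiffBump (0 : ℝ)) : ContDiff ℝ ((⊤ : ℕ∞) : WithTop ℕ∞) fun x => (β x : ℂ) :=
    Complex.ofRealCLM.contDiff.comp β.contDiff
  let b : 𝓢(ℝ, ℂ) := (hc β₁).toSchwartzMap (hd β₁)
  let b₂ : 𝓢(ℝ, ℂ) := (hc β₂).toSchwartzMap (hd β₂)
  have hb (x : ℝ) : b x = (β₁ x : ℂ) := rfl
  have hb₂ (x : ℝ) : b₂ x = (β₂ x : ℂ) := rfl
  have hmul (x : ℝ) : b x * b₂ x = b x := by
    rw [hb, hb₂]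
    by_cases hx : x ∈ Metric.closedBall (0 : ℝ) 2
    · rw [β₂.one_of_mem_closedBall hx]; simp
    · rw [β₁.zero_of_le_dist (not_le.1 hx).le]; simp
  have hfi : 𝓕 b = 𝓕⁻ b := by
    ext x
    rw [fourier_coe, fourierInv_coe, Real.fourierInv_eq_fourier_comp_neg]
    have : (fun y => b (-y)) = b := funext fun y => by rw [hb, hb, β₁.neg]
    rw [this]
  refine ⟨b, 𝓕⁻ b₂, hc β₁, ?_, ?_, ?_⟩
  · rw [hb, β₁.one_of_mem_closedBall (by simp [β₁])]; simp
  · rw [fourier_coe, Real.fourier_real_eq]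
    simp only [mul_zero, neg_zero, AddChar.map_zero_eq_one, one_smul, hb]
    rw [integral_complex_ofReal]
    exact_mod_cast (β₁.integral_pos (μ := volume)).ne'
  · intro x
    have key : SchwartzMap.convolution (ContinuousLinearMap.mul ℂ ℂ) (𝓕⁻ b₂) (𝓕⁻ b) = 𝓕⁻ b := by
      rw [← FourierTransform.fourierInv_fourier_eq (F := 𝓢(ℝ, ℂ))
        (SchwartzMap.convolution (ContinuousLinearMap.mul ℂ ℂ) (𝓕⁻ b₂) (𝓕⁻ b))]
      refine congrArg _ (SchwartzMap.ext fun y => ?_)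
      rw [SchwartzMap.fourier_convolution, FourierTransform.fourier_fourierInv_eq,
        FourierTransform.fourier_fourierInv_eq]
      simp [hmul, mul_comm]
    rw [hfi]
    conv_rhs => rw [← key, SchwartzMap.convolution_apply]
    simp [MeasureTheory.convolution, mul_comm]

theorem tendsto_integral_norm_sub_translate (k : 𝓢(ℝ, ℂ)) :
    Tendsto (fun t : ℝ => ∫ z, ‖k z - k (z - t)‖) (𝓝 0) (𝓝 0) := by
  obtain ⟨C, hC⟩ : ∃ C, ∀ z, ‖k z‖ ≤ C * (1 + z ^ 2)⁻¹ := by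
    obtain ⟨C₀, h0⟩ := k.decay 0 0
    obtain ⟨C₂, h2⟩ := k.decay 2 0
    refine ⟨C₀ + C₂, fun z => ?_⟩
    have h0' := h0.2 z
    have h2' := h2.2 z
    simp only [norm_iteratedFDeriv_zero, pow_zero, one_mul, Real.norm_eq_abs, sq_abs] at h0' h2'
    rw [← div_eq_mul_inv, le_div_iff₀ (by positivity)]
    linarith
  have h0 : ∫ z, ‖k z - k (z - 0)‖ = 0 := by simp
  conv => enter [3]; rw [← h0]
  have hC0 : 0 ≤ C := by
    have := (norm_nonneg _).trans (hC 0)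
    simpa using this
  refine tendsto_integral_filter_of_dominated_convergence
    (fun z => C * (1 + z ^ 2)⁻¹ + 3 * C * (1 + z ^ 2)⁻¹) ?_ ?_ ?_ ?_
  · exact Eventually.of_forall fun t => by
      have := k.continuous
      exact Continuous.aestronglyMeasurable (by fun_prop)
  · filter_upwards [Metric.closedBall_mem_nhds (0 : ℝ) one_pos] with t ht
    refine Eventually.of_forall fun z => ?_
    rw [norm_norm]
    refine (norm_sub_le _ _).trans (add_le_add (hC z) ((hC _).trans ?_))
    rw [mul_comm 3 C, mul_assoc]
    refine mul_le_mul_of_nonneg_left ?_ hC0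
    -- The factor 3 comes from z² ≤ 2(z - t)² + 2t² and |t| ≤ 1.
    rw [← div_eq_mul_inv, ← one_div, div_le_div_iff₀ (by positivity) (by positivity)]
    have ht' : t ^ 2 ≤ 1 := by
      rw [mem_closedBall_zero_iff, Real.norm_eq_abs] at ht
      exact (sq_le_one_iff_abs_le_one t).2 ht
    nlinarith [sq_nonneg (z - 2 * t), sq_nonneg z]
  · exact (integrable_inv_one_add_sq.const_mul _).add (integrable_inv_one_add_sq.const_mul _)
  · refine Eventually.of_forall fun z => ?_
    have := k.continuous
    exact Continuous.tendsto (f := fun t => ‖k z - k (z - t)‖) (by fun_prop) 0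

theorem integral_norm_sub_translate_le (k : 𝓢(ℝ, ℂ)) (t : ℝ) :
    ∫ z, ‖k z - k (z - t)‖ ≤ 2 * ∫ z, ‖k z‖ := by
  have h1 : Integrable (fun z => ‖k z‖) := k.integrable.norm
  have h2 : Integrable (fun z => ‖k (z - t)‖) := h1.comp_sub_right t
  calc _ ≤ ∫ z, (‖k z‖ + ‖k (z - t)‖) :=
        integral_mono (k.integrable.sub (k.integrable.comp_sub_right t)).norm (h1.add h2)
          fun z => norm_sub_le _ _
    _ = _ := by
      rw [integral_add h1 h2, integral_sub_right_eq_self (fun z => ‖k z‖) t]; ring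

theorem measurable_integral_norm_sub_translate (k : 𝓢(ℝ, ℂ)) :
    Measurable fun t : ℝ => ∫ z, ‖k z - k (z - t)‖ := by
  have := k.continuous
  have h : Continuous fun p : ℝ × ℝ => ‖k p.2 - k (p.2 - p.1)‖ := by fun_prop
  exact (h.stronglyMeasurable.integral_prod_right' (ν := volume)).measurable

/-! ### Wiener's theorem for bounded continuous functions -/

section Wiener

variable {Ω : Type*} [MeasurableSpace Ω] {P : Measure Ω} [SFinite P] {Y : Ω → ℝ} {h : Ω → ℂ}
  {g : ℝ → ℂ} {B : ℝ}

theorem integrable_bounded_mul {X : Type*} [MeasurableSpace X] {μ : Measure X} {f u : X → ℂ}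
    (hf : Integrable f μ) (hu : AEStronglyMeasurable u μ) (hB : ∀ x, ‖u x‖ ≤ B) :
    Integrable (fun x => u x * f x) μ :=
  hf.bdd_mul hu (Eventually.of_forall hB)

/-- A bounded function annihilated by a weight whose Fourier transform does not vanish at `0` has
no low frequencies. -/
theorem integral_mul_eq_zero_of_small (hY : Measurable Y) (hh : Integrable h P)
    (hgc : Continuous g) (hgb : ∀ x, ‖g x‖ ≤ B) (q k : 𝓢(ℝ, ℂ))
    (hqk : ∀ x, ∫ z, q (x - z) * k z = q x) (hconv : ∀ x, ∫ ω, g (x + Y ω) * h ω ∂P = 0)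
    (hsmall : ∫ ω, ‖h ω‖ * (∫ z, ‖k z - k (z - Y ω)‖) ∂P < ‖∫ ω, h ω ∂P‖) (x : ℝ) :
    ∫ y, g (x + y) * q y = 0 := by
  have hqc := q.continuous
  have hkc := k.continuous
  set Q : ℝ → ℂ := fun x => ∫ y, g (x + y) * q y with hQ
  have hQint (x : ℝ) : Integrable fun y => g (x + y) * q y :=
    integrable_bounded_mul q.integrable
      (Continuous.aestronglyMeasurable (by fun_prop)) fun y => hgb _
  have hQb (x : ℝ) : ‖Q x‖ ≤ B * ∫ y, ‖q y‖ := by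
    rw [← integral_const_mul]
    refine norm_integral_le_of_norm_le (q.integrable.norm.const_mul B) ?_
    refine Eventually.of_forall fun y => ?_
    rw [norm_mul]
    exact mul_le_mul_of_nonneg_right (hgb _) (norm_nonneg _)
  have hQc : Continuous Q := by
    refine continuous_of_dominated (bound := fun y => B * ‖q y‖)
      (fun x => (hQint x).aestronglyMeasurable) (fun x => Eventually.of_forall fun y => ?_)
      (q.integrable.norm.const_mul B) (Eventually.of_forall fun y => by fun_prop)
    rw [norm_mul]
    exact mul_le_mul_of_nonneg_right (hgb _) (norm_nonneg _)
  -- `Q` inherits the reproducing property of `q`, so its increments are controlled by translates of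
  -- `k` alone.
  have hQk (x : ℝ) : Q x = ∫ z, Q (x + z) * k z := by
    have hI : Integrable (fun p : ℝ × ℝ => g (x + p.1) * (q (p.1 - p.2) * k p.2))
        (volume.prod volume) := by
      refine integrable_bounded_mul ?_ (Continuous.aestronglyMeasurable (by fun_prop))
        fun p => hgb _
      have := k.integrable (μ := volume).convolution_integrand (ContinuousLinearMap.mul ℂ ℂ)
        (q.integrable (μ := volume))
      simpa [mul_comm] using this
    calc Q x = ∫ y, ∫ z, g (x + y) * (q (y - z) * k z) := by
          simp only [hQ, integral_const_mul, hqk]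
      _ = ∫ z, ∫ y, g (x + y) * (q (y - z) * k z) := integral_integral_swap hI
      _ = ∫ z, Q (x + z) * k z := by
          refine integral_congr_ae (Eventually.of_forall fun z => ?_)
          simp only [hQ]
          rw [← integral_mul_const,
            ← integral_add_right_eq_self (fun y => g (x + y) * (q (y - z) * k z)) z]
          refine integral_congr_ae (Eventually.of_forall fun y => ?_)
          simp only [add_sub_cancel_right]
          rw [show x + (y + z) = x + z + y by ring, mul_assoc]
  have hQconv (x : ℝ) : ∫ ω, Q (x + Y ω) * h ω ∂P = 0 := by
    have hI : Integrable (fun p : Ω × ℝ => g (x + Y p.1 + p.2) * (h p.1 * q p.2))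
        (P.prod volume) := by
      refine integrable_bounded_mul (hh.mul_prod q.integrable) ?_ fun p => hgb _
      exact (hgc.measurable.comp (by fun_prop)).aestronglyMeasurable
    calc ∫ ω, Q (x + Y ω) * h ω ∂P = ∫ ω, (∫ y, g (x + Y ω + y) * (h ω * q y)) ∂P := by
          refine integral_congr_ae (Eventually.of_forall fun ω => ?_)
          simp only [hQ]
          rw [← integral_mul_const]
          congr 1; ext y; ring
      _ = ∫ y : ℝ, ∫ ω, g (x + Y ω + y) * (h ω * q y) ∂P := integral_integral_swap hI
      _ = ∫ y : ℝ, (∫ ω, g (x + y + Y ω) * h ω ∂P) * q y := by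
          congr 1; ext y
          rw [← integral_mul_const]
          congr 1; ext ω
          rw [add_right_comm]; ring
      _ = 0 := by simp [hconv]
  have hQk' (x t : ℝ) : Q (x + t) = ∫ z, Q (x + z) * k (z - t) := by
    rw [hQk, ← integral_add_right_eq_self (fun z => Q (x + z) * k (z - t)) t]
    congr 1; ext z
    rw [add_sub_cancel_right, add_right_comm, add_assoc]
  have hQki (x t : ℝ) : Integrable fun z => Q (x + z) * k (z - t) :=
    integrable_bounded_mul (k.integrable.comp_sub_right t)
      (Continuous.aestronglyMeasurable (by fun_prop)) fun y => hQb _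
  set η := ∫ ω, ‖h ω‖ * (∫ z, ‖k z - k (z - Y ω)‖) ∂P with hη
  have hηi : Integrable (fun ω => ‖h ω‖ * (∫ z, ‖k z - k (z - Y ω)‖)) P := by
    refine hh.norm.mul_bdd (c := 2 * ∫ z, ‖k z‖)
      ((measurable_integral_norm_sub_translate k).comp hY).aestronglyMeasurable
      (Eventually.of_forall fun ω => ?_)
    rw [Real.norm_of_nonneg (integral_nonneg fun _ => norm_nonneg _)]
    exact integral_norm_sub_translate_le k _
  -- As `Q` is annihilated, Q(x) ∫ h = ∫ (Q(x) - Q(x + Y)) h, and |Q(x) - Q(x + t)| ≤ S ‖k - k(· -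
  -- t)‖₁. For S = sup |Q| this forces S = 0, because `η < ‖∫ h‖`.
  have step (S : ℝ) (hS : ∀ x, ‖Q x‖ ≤ S) (x : ℝ) : ‖Q x‖ * ‖∫ ω, h ω ∂P‖ ≤ S * η := by
    have hi : Integrable (fun ω => Q (x + Y ω) * h ω) P :=
      integrable_bounded_mul hh (hQc.measurable.comp (by fun_prop)).aestronglyMeasurable
        fun y => hQb _
    have e : Q x * ∫ ω, h ω ∂P = ∫ ω, (Q x - Q (x + Y ω)) * h ω ∂P := by
      simp_rw [sub_mul]
      rw [integral_sub (hh.const_mul _) hi, hQconv, integral_const_mul, sub_zero]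
    rw [← norm_mul, e, hη, ← integral_const_mul]
    refine norm_integral_le_of_norm_le (hηi.const_mul S) (Eventually.of_forall fun ω => ?_)
    have e2 : Q x - Q (x + Y ω) = ∫ z, Q (x + z) * (k z - k (z - Y ω)) := by
      have h1 := hQk' x 0
      have h2 := hQki x 0
      simp only [add_zero, sub_zero] at h1 h2
      rw [hQk' x (Y ω), h1, ← integral_sub h2 (hQki x _)]
      simp_rw [mul_sub]
    rw [norm_mul, e2, mul_comm ‖h ω‖, ← mul_assoc]
    refine mul_le_mul_of_nonneg_right ?_ (norm_nonneg _)
    rw [← integral_const_mul]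
    refine norm_integral_le_of_norm_le
      ((k.integrable.sub (k.integrable.comp_sub_right _)).norm.const_mul S)
      (Eventually.of_forall fun z => ?_)
    rw [norm_mul]
    exact mul_le_mul_of_nonneg_right (hS _) (norm_nonneg _)
  have hbdd : BddAbove (range fun x => ‖Q x‖) := ⟨_, forall_mem_range.2 hQb⟩
  set S := ⨆ x, ‖Q x‖ with hSdef
  have hS (x : ℝ) : ‖Q x‖ ≤ S := le_ciSup hbdd x
  have hη0 : 0 ≤ η := integral_nonneg fun ω =>
    mul_nonneg (norm_nonneg _) (integral_nonneg fun _ => norm_nonneg _)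
  have ha : 0 < ‖∫ ω, h ω ∂P‖ := hη0.trans_lt hsmall
  have hle : S ≤ S * η / ‖∫ ω, h ω ∂P‖ :=
    ciSup_le fun x => (le_div_iff₀ ha).2 (step S hS x)
  rw [le_div_iff₀ ha] at hle
  have hS0 : S ≤ 0 := by
    by_contra! hpos
    exact (mul_lt_mul_of_pos_left hsmall hpos).not_ge hle
  exact norm_le_zero_iff.1 ((hS x).trans hS0)

end Wiener

section Wiener

variable {Ω : Type*} [MeasurableSpace Ω] {P : Measure Ω} {Y : Ω → ℝ} {h : Ω → ℂ}
  {g : ℝ → ℂ} {B : ℝ}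

/-- A lower bound uniform in `ξ` lets a single filter width serve a whole compact range of
frequencies. -/
theorem exists_pos_le_norm_fourier (hY : Measurable Y) (hh : Integrable h P)
    (hne : ∀ ξ : ℝ, ∫ ω, Complex.exp ((ξ * Y ω : ℝ) * Complex.I) * h ω ∂P ≠ 0) (N : ℝ) :
    ∃ m > 0, ∀ ξ ∈ Icc (-N) N, m ≤ ‖∫ ω, Complex.exp ((ξ * Y ω : ℝ) * Complex.I) * h ω ∂P‖ := by
  have hc : Continuous fun ξ : ℝ => ∫ ω, Complex.exp ((ξ * Y ω : ℝ) * Complex.I) * h ω ∂P := by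
    refine continuous_of_dominated (bound := fun ω => ‖h ω‖) (fun ξ => ?_)
      (fun ξ => Eventually.of_forall fun ω => ?_) hh.norm
      (Eventually.of_forall fun ω => by fun_prop)
    · exact (Measurable.aestronglyMeasurable (by fun_prop)).mul hh.aestronglyMeasurable
    · rw [norm_mul, Complex.norm_exp_ofReal_mul_I, one_mul]
  rcases (Icc (-N) N).eq_empty_or_nonempty with h0 | h0
  · exact ⟨1, one_pos, by simp [h0]⟩
  · obtain ⟨ξ, -, hξ⟩ := isCompact_Icc.exists_isMinOn h0 hc.norm.continuousOn
    exact ⟨_, norm_pos_iff.2 (hne ξ), fun η hη => hξ hη⟩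

variable [SFinite P]

/-- Low-pass filters of sufficiently small width, centred at any frequency in a bounded range,
annihilate `g`. -/
theorem eventually_integral_modulation_eq_zero (hY : Measurable Y) (hh : Integrable h P)
    (hne : ∀ ξ : ℝ, ∫ ω, Complex.exp ((ξ * Y ω : ℝ) * Complex.I) * h ω ∂P ≠ 0)
    (hgc : Continuous g) (hgb : ∀ x, ‖g x‖ ≤ B) (q k : 𝓢(ℝ, ℂ))
    (hqk : ∀ x, ∫ z, q (x - z) * k z = q x) (hconv : ∀ x, ∫ ω, g (x + Y ω) * h ω ∂P = 0) (N : ℝ) :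
    ∀ᶠ δ in 𝓝[>] (0 : ℝ), ∀ ξ ∈ Icc (-N) N,
      ∫ y, g y * Complex.exp (-(ξ * y : ℝ) * Complex.I) * q (δ * y) = 0 := by
  obtain ⟨m, hm, hmle⟩ := exists_pos_le_norm_fourier hY hh hne N
  have hlim : Tendsto (fun δ : ℝ => ∫ ω, ‖h ω‖ * (∫ z, ‖k z - k (z - δ * Y ω)‖) ∂P)
      (𝓝 0) (𝓝 0) := by
    have e0 : (0 : ℝ) = ∫ ω, ‖h ω‖ * 0 ∂P := by simp
    conv => enter [3]; rw [e0]
    refine tendsto_integral_filter_of_dominated_convergence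
      (fun ω => ‖h ω‖ * (2 * ∫ z, ‖k z‖)) ?_ ?_ (hh.norm.mul_const _) ?_
    · exact Eventually.of_forall fun δ => hh.norm.aestronglyMeasurable.mul
        ((measurable_integral_norm_sub_translate k).comp (hY.const_mul δ)).aestronglyMeasurable
    · refine Eventually.of_forall fun δ => Eventually.of_forall fun ω => ?_
      rw [norm_mul, norm_norm, Real.norm_of_nonneg (integral_nonneg fun _ => norm_nonneg _)]
      exact mul_le_mul_of_nonneg_left (integral_norm_sub_translate_le k _) (norm_nonneg _)
    · refine Eventually.of_forall fun ω => ?_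
      refine Tendsto.const_mul _ ((tendsto_integral_norm_sub_translate k).comp ?_)
      exact Continuous.tendsto' (by fun_prop) _ _ (zero_mul _)
  filter_upwards [nhdsWithin_le_nhds (hlim.eventually_lt_const hm), self_mem_nhdsWithin]
    with δ hδ hδ0 ξ hξ
  rw [mem_Ioi] at hδ0
  -- Dilating by `δ` replaces `Y` by `δ * Y`, which makes the smallness condition hold; modulating
  -- `g` and `h` in opposite senses moves frequency `ξ` to 0 and keeps the convolution zero.
  have key := integral_mul_eq_zero_of_small (P := P) (Y := fun ω => δ * Y ω)
    (h := fun ω => Complex.exp ((ξ * Y ω : ℝ) * Complex.I) * h ω)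
    (g := fun x => g (x / δ) * Complex.exp (-(ξ * (x / δ) : ℝ) * Complex.I)) (B := B)
    (hY.const_mul δ) ?_ (by fun_prop) ?_ q k hqk ?_ ?_ 0
  · simp only [zero_add] at key
    have e := Measure.integral_comp_mul_left (fun y =>
      g (y / δ) * Complex.exp (-(ξ * (y / δ) : ℝ) * Complex.I) * q y) δ
    rw [key, smul_zero] at e
    rw [← e]
    congr 1; ext y
    rw [mul_div_cancel_left₀ _ hδ0.ne']
  · refine integrable_bounded_mul (B := 1) hh (Measurable.aestronglyMeasurable (by fun_prop))
      fun ω => ?_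
    rw [Complex.norm_exp_ofReal_mul_I]
  · intro x
    rw [norm_mul, ← Complex.ofReal_neg, Complex.norm_exp_ofReal_mul_I, mul_one]
    exact hgb _
  · intro x
    have e : ∀ ω, g ((x + δ * Y ω) / δ) *
          Complex.exp (-(ξ * ((x + δ * Y ω) / δ) : ℝ) * Complex.I) *
          (Complex.exp ((ξ * Y ω : ℝ) * Complex.I) * h ω) =
        Complex.exp (-(ξ * (x / δ) : ℝ) * Complex.I) * (g (x / δ + Y ω) * h ω) := by
      intro ω
      have e1 : (x + δ * Y ω) / δ = x / δ + Y ω := by field_simp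
      have e2 : Complex.exp (-(ξ * (x / δ + Y ω) : ℝ) * Complex.I) *
          Complex.exp ((ξ * Y ω : ℝ) * Complex.I) =
          Complex.exp (-(ξ * (x / δ) : ℝ) * Complex.I) := by
        rw [← Complex.exp_add]
        congr 1
        push_cast
        ring
      rw [e1, ← e2]
      ring
    simp_rw [e]
    rw [integral_const_mul, hconv, mul_zero]
  · refine lt_of_lt_of_le ?_ (hmle ξ hξ)
    simpa only [norm_mul, Complex.norm_exp_ofReal_mul_I, one_mul] using hδ

/-- `𝓕 b` is a superposition of characters with frequencies in the compact support of `b`. By Fubini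
∫ g(y) q(δy) q(y) dy = 0 for small `δ`, where `q = 𝓕 b`; letting δ → 0 leaves q(0) ∫ g q = 0. -/
theorem integral_mul_fourier_eq_zero (hY : Measurable Y) (hh : Integrable h P)
    (hne : ∀ ξ : ℝ, ∫ ω, Complex.exp ((ξ * Y ω : ℝ) * Complex.I) * h ω ∂P ≠ 0)
    (hgc : Continuous g) (hgb : ∀ x, ‖g x‖ ≤ B) (b k : 𝓢(ℝ, ℂ)) (hb : HasCompactSupport b)
    (hqk : ∀ x, ∫ z, 𝓕 b (x - z) * k z = 𝓕 b x) (hb0 : 𝓕 b 0 ≠ 0)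
    (hconv : ∀ x, ∫ ω, g (x + Y ω) * h ω ∂P = 0) :
    ∫ y, g y * 𝓕 b y = 0 := by
  set q : 𝓢(ℝ, ℂ) := 𝓕 b with hq
  have hqc := q.continuous
  have hbc := b.continuous
  obtain ⟨R, hR⟩ : ∃ R, ∀ v, b v ≠ 0 → ‖v‖ ≤ R := by
    obtain ⟨R, hR⟩ := hb.isCompact.isBounded.exists_norm_le
    exact ⟨R, fun v hv => hR v (subset_tsupport _ hv)⟩
  obtain ⟨Cq, hCq⟩ := q.decay 0 0
  replace hCq : ∀ x, ‖q x‖ ≤ Cq := by simpa using hCq.2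
  have hprod : ∀ᶠ δ in 𝓝[>] (0 : ℝ), ∫ y, g y * q (δ * y) * q y = 0 := by
    filter_upwards [eventually_integral_modulation_eq_zero hY hh hne hgc hgb q k hqk hconv
      (2 * Real.pi * R), self_mem_nhdsWithin] with δ hδ hδ0
    rw [mem_Ioi] at hδ0
    have hqδ : Integrable fun y => q (δ * y) := q.integrable.comp_mul_left' hδ0.ne'
    have hI : Integrable (fun p : ℝ × ℝ =>
        (g p.1 * Complex.exp (-(2 * Real.pi * p.2 * p.1 : ℝ) * Complex.I)) * (q (δ * p.1) * b p.2))
        (volume.prod volume) := by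
      refine integrable_bounded_mul (B := B) (hqδ.mul_prod b.integrable)
        (Continuous.aestronglyMeasurable (by fun_prop)) fun p => ?_
      rw [norm_mul, ← Complex.ofReal_neg, Complex.norm_exp_ofReal_mul_I, mul_one]
      exact hgb _
    calc ∫ y, g y * q (δ * y) * q y
        = ∫ y : ℝ, ∫ v : ℝ, (g y * Complex.exp (-(2 * Real.pi * v * y : ℝ) * Complex.I)) *
            (q (δ * y) * b v) := by
          congr 1; ext y
          conv_lhs => enter [2]; rw [hq, fourier_coe, Real.fourier_real_eq_integral_exp_smul]
          rw [← integral_const_mul]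
          congr 1; ext v
          rw [smul_eq_mul]
          push_cast
          ring_nf
      _ = ∫ v : ℝ, ∫ y : ℝ, (g y * Complex.exp (-(2 * Real.pi * v * y : ℝ) * Complex.I)) *
            (q (δ * y) * b v) := integral_integral_swap hI
      _ = ∫ v : ℝ, 0 := by
          congr 1; ext v
          by_cases hv : b v = 0
          · simp [hv]
          · have hv' := abs_le.1 (hR v hv)
            have := hδ (2 * Real.pi * v) ⟨by nlinarith [Real.pi_pos], by nlinarith [Real.pi_pos]⟩
            simp_rw [← mul_assoc]
            rw [integral_mul_const, this, zero_mul]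
      _ = 0 := by simp
  have hlim : Tendsto (fun δ : ℝ => ∫ y, g y * q (δ * y) * q y) (𝓝[>] 0)
      (𝓝 (∫ y, g y * q 0 * q y)) := by
    refine tendsto_integral_filter_of_dominated_convergence (fun y => B * Cq * ‖q y‖) ?_ ?_
      (q.integrable.norm.const_mul _) ?_
    · exact Eventually.of_forall fun δ => Continuous.aestronglyMeasurable (by fun_prop)
    · refine Eventually.of_forall fun δ => Eventually.of_forall fun y => ?_
      rw [norm_mul, norm_mul]
      gcongr
      · exact (norm_nonneg _).trans (hgb 0)
      · exact hgb _
      · exact hCq _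
    · refine Eventually.of_forall fun y => Tendsto.mono_left ?_ nhdsWithin_le_nhds
      exact Continuous.tendsto' (by fun_prop) _ _ (by rw [zero_mul])
  have h0 := tendsto_nhds_unique (hlim.congr' hprod) tendsto_const_nhds
  have e : ∫ y, g y * q 0 * q y = q 0 * ∫ y, g y * q y := by
    rw [← integral_const_mul]
    congr 1; ext y; ring
  rw [e] at h0
  exact (mul_eq_zero.1 h0).resolve_left hb0

/-- **Wiener's Tauberian theorem** for bounded continuous functions: if the law of `Y` weighted by
`h` has a nowhere vanishing Fourier transform, convolution with it is injective. -/
theorem eq_zero_of_forall_integral_add_mul_eq_zero (hY : Measurable Y) (hh : Integrable h P)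
    (hne : ∀ ξ : ℝ, ∫ ω, Complex.exp ((ξ * Y ω : ℝ) * Complex.I) * h ω ∂P ≠ 0)
    (hgc : Continuous g) (hgb : ∀ x, ‖g x‖ ≤ B)
    (hconv : ∀ x, ∫ ω, g (x + Y ω) * h ω ∂P = 0) (x : ℝ) : g x = 0 := by
  obtain ⟨b, k, hb, hb0, hq0, hqk⟩ := exists_schwartz_reproducing
  -- The hypotheses survive translating and rescaling `g`, with `Y` replaced by `Y / r`. As r → 0
  -- the averages concentrate at `x`, with total mass `b 0 ≠ 0`.
  have hscale : ∀ r : ℝ, 0 < r → ∫ y, g (x + r * y) * 𝓕 b y = 0 := by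
    intro r hr
    refine integral_mul_fourier_eq_zero (P := P) (h := h) (Y := fun ω => Y ω / r)
      (g := fun y => g (x + r * y)) (hY.div_const r) hh (fun ξ => ?_) (by fun_prop)
      (fun y => hgb _) b k hb hqk hq0 fun y => ?_
    · have := hne (ξ / r)
      simpa only [div_mul_eq_mul_div, mul_div_assoc] using this
    · have := hconv (x + r * y)
      convert this using 5
      field_simp
      ring
  have hlim : Tendsto (fun r : ℝ => ∫ y, g (x + r * y) * 𝓕 b y) (𝓝[>] 0)
      (𝓝 (∫ y, g x * 𝓕 b y)) := by
    have hqc := (𝓕 b).continuous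
    refine tendsto_integral_filter_of_dominated_convergence (fun y => B * ‖𝓕 b y‖) ?_ ?_
      ((𝓕 b).integrable.norm.const_mul _) ?_
    · exact Eventually.of_forall fun δ => Continuous.aestronglyMeasurable (by fun_prop)
    · refine Eventually.of_forall fun δ => Eventually.of_forall fun y => ?_
      rw [norm_mul]
      exact mul_le_mul_of_nonneg_right (hgb _) (norm_nonneg _)
    · refine Eventually.of_forall fun y => Tendsto.mono_left ?_ nhdsWithin_le_nhds
      exact Continuous.tendsto' (by fun_prop) _ _ (by simp)
  have hev : ∀ᶠ r in 𝓝[>] (0 : ℝ), ∫ y, g (x + r * y) * 𝓕 b y = 0 :=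
    eventually_nhdsWithin_of_forall fun r hr => hscale r hr
  have h0 := tendsto_nhds_unique (hlim.congr' hev) tendsto_const_nhds
  have hinv : ∫ y, 𝓕 b y = b 0 := by
    have e : 𝓕⁻ (𝓕 b) 0 = b 0 := by rw [FourierTransform.fourierInv_fourier_eq]
    rw [← e, fourierInv_coe, Real.fourierInv_eq_fourier_neg, Real.fourier_real_eq]
    simp
  rw [integral_const_mul, hinv] at h0
  exact (mul_eq_zero.1 h0).resolve_right hb0

end Wiener

/-! ### Tails and scaling of the power measure -/

/-- `ν` has tails of order at most `p ^ (-α)`. -/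
def HasTailBound (α : ℝ) (C : ℝ≥0∞) (ν : Measure ℝ) : Prop :=
  ∀ p : ℝ, 0 < p → ν (Ici p) ≤ C * ENNReal.ofReal (p ^ (-α))

theorem powerTail_Ici {α p : ℝ} (hα : 0 < α) (hp : 0 < p) :
    powerTail α (Ici p) = ENNReal.ofReal (p ^ (-α)) := by
  rw [powerTail, withDensity_apply _ measurableSet_Ici, Measure.restrict_restrict measurableSet_Ici,
    inter_eq_left.2 (Ici_subset_Ioi.2 hp), setLIntegral_congr Ioi_ae_eq_Ici.symm,
    ← ofReal_integral_eq_lintegral_ofReal]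
  · rw [integral_const_mul, integral_Ioi_rpow_of_lt (by linarith) hp]
    congr 1
    rw [show -(α + 1) + 1 = -α by ring]
    field_simp
  · exact (integrableOn_Ioi_rpow_of_lt (by linarith) hp).const_mul α
  · filter_upwards [self_mem_ae_restrict measurableSet_Ioi] with x hx
    exact mul_nonneg hα.le (Real.rpow_nonneg (hp.trans hx).le _)

theorem hasTailBound_powerTail {α : ℝ} (hα : 0 < α) : HasTailBound α 1 (powerTail α) :=
  fun p hp => by rw [powerTail_Ici hα hp, one_mul]

theorem powerTail_Iic_zero (α : ℝ) : powerTail α (Iic 0) = 0 := by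
  rw [powerTail, withDensity_apply _ measurableSet_Iic, Measure.restrict_restrict measurableSet_Iic,
    Iic_inter_Ioi, Ioc_self]
  simp

theorem integral_powerTail {α : ℝ} (hα : 0 < α) (f : ℝ → ℝ) :
    ∫ y, f y ∂powerTail α = ∫ y in Ioi 0, α * y ^ (-(α + 1)) * f y := by
  rw [powerTail, integral_withDensity_eq_integral_toReal_smul (by fun_prop) (by simp)]
  refine setIntegral_congr_fun measurableSet_Ioi fun y hy => ?_
  simp only [smul_eq_mul]
  rw [ENNReal.toReal_ofReal (mul_nonneg hα.le (Real.rpow_nonneg (mem_Ioi.1 hy).le _))]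

theorem integral_powerTail_comp_mul {α p : ℝ} (hα : 0 < α) (hp : 0 < p) (f : ℝ → ℝ) :
    ∫ y, f (p * y) ∂powerTail α = p ^ α * ∫ y, f y ∂powerTail α := by
  rw [integral_powerTail hα, integral_powerTail hα]
  have key := integral_comp_mul_left_Ioi (fun y => α * y ^ (-(α + 1)) * f y) 0 hp
  rw [mul_zero] at key
  have e : ∫ y in Ioi 0, α * y ^ (-(α + 1)) * f (p * y) =
      ∫ y in Ioi 0, p ^ (α + 1) * (α * (p * y) ^ (-(α + 1)) * f (p * y)) := by
    refine setIntegral_congr_fun measurableSet_Ioi fun y hy => ?_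
    rw [Real.mul_rpow hp.le (mem_Ioi.1 hy).le, Real.rpow_neg hp.le (α + 1)]
    field_simp
  rw [e, integral_const_mul, key, smul_eq_mul, ← mul_assoc, Real.rpow_add_one hp.ne',
    mul_inv_cancel_right₀ hp.ne']

/-! ### Bounds on a factor from bounds on the convolution -/

section Convolution

variable {ν ρ : Measure ℝ} [SigmaFinite ν] [SigmaFinite ρ]

/-- Multiplication maps [a, ∞) × [p, ∞) into [ap, ∞), so ν[p, ∞) ρ[a, ∞) is at most the
convolution's tail at ap; choose `a` with ρ[a, ∞) > 0. -/
theorem exists_hasTailBound_of_mconv_le {α : ℝ} (hα : 0 < α) (hρ : ρ (Ioi 0)ᶜ = 0) (hρ0 : ρ ≠ 0)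
    {C : ℝ≥0∞} (hC : C ≠ ∞) (hle : Measure.mconv ν ρ ≤ C • powerTail α) :
    ∃ C' ≠ ∞, HasTailBound α C' ν := by
  obtain ⟨n, hn⟩ : ∃ n : ℕ, ρ (Ici (1 / ((n : ℝ) + 1))) ≠ 0 := by
    by_contra! h
    refine hρ0 (Measure.measure_univ_eq_zero.1 ?_)
    rw [← union_compl_self (Ioi (0 : ℝ))]
    refine measure_union_null (measure_mono_null ?_ (measure_iUnion_null h)) hρ
    intro x hx
    obtain ⟨n, hn⟩ := exists_nat_one_div_lt (mem_Ioi.1 hx)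
    exact mem_iUnion.2 ⟨n, hn.le⟩
  set a : ℝ := 1 / ((n : ℝ) + 1) with ha
  have ha0 : 0 < a := by positivity
  refine ⟨C * ENNReal.ofReal (a ^ (-α)) / ρ (Ici a),
    ENNReal.div_ne_top (ENNReal.mul_ne_top hC ENNReal.ofReal_ne_top) hn, fun p hp => ?_⟩
  have h1 : ν (Ici p) * ρ (Ici a) ≤ C * ENNReal.ofReal ((a * p) ^ (-α)) := by
    calc ν (Ici p) * ρ (Ici a) = ∫⁻ _ in Ici a, ν (Ici p) ∂ρ := by simp
      _ ≤ ∫⁻ x in Ici a, ν ((fun y : ℝ => x * y) ⁻¹' Ici (a * p)) ∂ρ := by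
          refine setLIntegral_mono' measurableSet_Ici fun x hx => measure_mono fun y hy => ?_
          exact mul_le_mul hx hy hp.le (ha0.le.trans hx)
      _ ≤ ∫⁻ x, ν ((fun y : ℝ => x * y) ⁻¹' Ici (a * p)) ∂ρ := setLIntegral_le_lintegral _ _
      _ = Measure.mconv ν ρ (Ici (a * p)) :=
          (mconv_apply_eq_lintegral_dilation ν ρ measurableSet_Ici).symm
      _ ≤ (C • powerTail α) (Ici (a * p)) := hle _
      _ = C * ENNReal.ofReal ((a * p) ^ (-α)) := by
          rw [Measure.smul_apply, powerTail_Ici hα (mul_pos ha0 hp), smul_eq_mul]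
  rw [Real.mul_rpow ha0.le hp.le, ENNReal.ofReal_mul (Real.rpow_nonneg ha0.le _), ← mul_assoc] at h1
  have hlt : ρ (Ici a) ≠ ∞ ∨ C * ENNReal.ofReal (a ^ (-α)) * ENNReal.ofReal (p ^ (-α)) ≠ ∞ :=
    Or.inr (ENNReal.mul_ne_top (ENNReal.mul_ne_top hC ENNReal.ofReal_ne_top) ENNReal.ofReal_ne_top)
  rw [← ENNReal.le_div_iff_mul_le (Or.inl hn) hlt] at h1
  rwa [ENNReal.mul_div_right_comm] at h1

/-- Every dilation fixes 0, so an atom of `ν` at 0 would survive in the convolution. -/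
theorem singleton_zero_null_of_mconv_le {α : ℝ} (hρ0 : ρ ≠ 0) {C : ℝ≥0∞}
    (hle : Measure.mconv ν ρ ≤ C • powerTail α) : ν {0} = 0 := by
  have h0 : (C • powerTail α) {0} = 0 := by
    rw [Measure.smul_apply, measure_mono_null (by simp) (powerTail_Iic_zero α), smul_zero]
  have h1 : ν {0} * ρ univ ≤ 0 := by
    calc ν {0} * ρ univ = ∫⁻ _, ν {0} ∂ρ := by simp
      _ ≤ ∫⁻ x, ν ((fun y : ℝ => x * y) ⁻¹' {0}) ∂ρ :=
          lintegral_mono fun x => measure_mono fun y hy => by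
            rw [mem_singleton_iff] at hy; simp [hy]
      _ = Measure.mconv ν ρ {0} :=
          (mconv_apply_eq_lintegral_dilation ν ρ (measurableSet_singleton 0)).symm
      _ ≤ 0 := (hle _).trans h0.le
  exact (mul_eq_zero.1 (le_zero_iff.1 h1)).resolve_right
    fun h => hρ0 (Measure.measure_univ_eq_zero.1 h)

end Convolution

/-! ### Testing measures against cutoffs -/

/-- Continuous functions with values in `[0, 1]` that vanish on `(-∞, 1/2)`. -/
structure IsCutoff (φ : ℝ → ℝ) : Prop where
  continuous : Continuous φ
  nonneg : ∀ y, 0 ≤ φ y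
  le_one : ∀ y, φ y ≤ 1
  eq_zero : ∀ y, y < 1 / 2 → φ y = 0

section Cutoff

variable {α : ℝ} {C : ℝ≥0∞} {ν : Measure ℝ} {φ : ℝ → ℝ}

/-- One integrable majorant for all dilations `p ≤ r`, as needed for dominated convergence. -/
theorem IsCutoff.norm_comp_mul_le (hφ : IsCutoff φ) {p r : ℝ} (hpr : p ≤ r) (hr : 0 < r) (hp : 0 < p)
    (y : ℝ) : ‖φ (p * y)‖ ≤ (Ici (2 * r)⁻¹).indicator (fun _ => (1 : ℝ)) y := by
  rw [Real.norm_of_nonneg (hφ.nonneg _)]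
  by_cases hy : y ∈ Ici (2 * r)⁻¹
  · rw [indicator_of_mem hy]; exact hφ.le_one _
  · rw [indicator_of_notMem hy, hφ.eq_zero]
    rw [mem_Ici, not_le, ← one_div, lt_div_iff₀ (by positivity)] at hy
    rcases le_or_gt y 0 with h | h
    · nlinarith
    · nlinarith

theorem HasTailBound.lt_top (hν : HasTailBound α C ν) (hC : C ≠ ∞) {p : ℝ} (hp : 0 < p) :
    ν (Ici p) < ∞ :=
  (hν p hp).trans_lt (ENNReal.mul_lt_top hC.lt_top ENNReal.ofReal_lt_top)

theorem HasTailBound.integrable_indicator (hν : HasTailBound α C ν) (hC : C ≠ ∞) {p : ℝ}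
    (hp : 0 < p) : Integrable ((Ici p).indicator fun _ => (1 : ℝ)) ν :=
  (integrable_indicator_iff measurableSet_Ici).2 (integrableOn_const (hν.lt_top hC hp).ne)

theorem IsCutoff.integrable_comp_mul (hφ : IsCutoff φ) (hν : HasTailBound α C ν) (hC : C ≠ ∞)
    {p : ℝ} (hp : 0 < p) : Integrable (fun y => φ (p * y)) ν := by
  have := hφ.continuous
  exact (hν.integrable_indicator hC (by positivity)).mono'
    (Continuous.aestronglyMeasurable (by fun_prop))
    (Eventually.of_forall (hφ.norm_comp_mul_le le_rfl hp hp))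

theorem IsCutoff.integral_comp_mul_le (hφ : IsCutoff φ) (hν : HasTailBound α C ν) (hC : C ≠ ∞)
    {p : ℝ} (hp : 0 < p) : ∫ y, φ (p * y) ∂ν ≤ C.toReal * 2 ^ α * p ^ α := by
  calc ∫ y, φ (p * y) ∂ν ≤ ∫ y, (Ici (2 * p)⁻¹).indicator (fun _ => (1 : ℝ)) y ∂ν :=
        integral_mono (hφ.integrable_comp_mul hν hC hp)
          (hν.integrable_indicator hC (by positivity))
          fun y => (le_abs_self _).trans (hφ.norm_comp_mul_le le_rfl hp hp y)
    _ = (ν (Ici (2 * p)⁻¹)).toReal := by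
        rw [integral_indicator measurableSet_Ici]; simp [Measure.real]
    _ ≤ (C * ENNReal.ofReal ((2 * p)⁻¹ ^ (-α))).toReal :=
        ENNReal.toReal_mono (ENNReal.mul_ne_top hC ENNReal.ofReal_ne_top)
          (hν _ (by positivity))
    _ = C.toReal * 2 ^ α * p ^ α := by
        rw [ENNReal.toReal_mul, ENNReal.toReal_ofReal (by positivity),
          Real.inv_rpow (by positivity), Real.rpow_neg (by positivity), inv_inv,
          Real.mul_rpow two_pos.le hp.le, mul_assoc]

theorem IsCutoff.integral_comp_mul_nonneg (hφ : IsCutoff φ) (p : ℝ) : 0 ≤ ∫ y, φ (p * y) ∂ν :=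
  integral_nonneg fun _ => hφ.nonneg _

theorem IsCutoff.continuous_integral_comp_exp_mul (hφ : IsCutoff φ) (hν : HasTailBound α C ν)
    (hC : C ≠ ∞) : Continuous fun u : ℝ => ∫ y, φ (Real.exp u * y) ∂ν := by
  have hc := hφ.continuous
  refine continuous_iff_continuousAt.2 fun u => ?_
  refine tendsto_integral_filter_of_dominated_convergence
    ((Ici (2 * Real.exp (u + 1))⁻¹).indicator fun _ => (1 : ℝ)) ?_ ?_
    (hν.integrable_indicator hC (by positivity)) ?_
  · exact Eventually.of_forall fun v => Continuous.aestronglyMeasurable (by fun_prop)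
  · filter_upwards [Iic_mem_nhds (lt_add_one u)] with v hv
    exact Eventually.of_forall
      (hφ.norm_comp_mul_le (Real.exp_le_exp.2 hv) (Real.exp_pos _) (Real.exp_pos _))
  · exact Eventually.of_forall fun y => Continuous.tendsto (by fun_prop) u

theorem measurable_integral_comp_mul [SFinite ν] (hφ : IsCutoff φ) (p : ℝ) :
    Measurable fun x : ℝ => ∫ y, φ (p * x * y) ∂ν := by
  have hc := hφ.continuous
  have h : Continuous fun q : ℝ × ℝ => φ (p * q.1 * q.2) := by fun_prop
  exact (h.stronglyMeasurable.integral_prod_right' (ν := ν)).measurable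

theorem IsCutoff.integrable_integral_comp_mul [SFinite ν] {ρ : Measure ℝ} (hφ : IsCutoff φ)
    (hν : HasTailBound α C ν) (hC : C ≠ ∞) (hρ : ∀ᵐ x ∂ρ, 0 < x)
    (hint : Integrable (fun x : ℝ => x ^ α) ρ) {p : ℝ} (hp : 0 < p) :
    Integrable (fun x => ∫ y, φ (p * x * y) ∂ν) ρ := by
  refine (hint.const_mul (C.toReal * 2 ^ α * p ^ α)).mono'
    (measurable_integral_comp_mul hφ p).aestronglyMeasurable ?_
  filter_upwards [hρ] with x hx
  rw [Real.norm_of_nonneg (hφ.integral_comp_mul_nonneg _)]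
  refine (hφ.integral_comp_mul_le hν hC (mul_pos hp hx)).trans_eq ?_
  rw [Real.mul_rpow hp.le hx.le, mul_assoc, mul_assoc, mul_assoc]

theorem IsCutoff.lintegral_mconv_eq [SigmaFinite ν] {ρ : Measure ℝ} [SigmaFinite ρ]
    (hφ : IsCutoff φ)
    (hν : HasTailBound α C ν) (hC : C ≠ ∞) (hρ : ∀ᵐ x ∂ρ, 0 < x)
    (hint : Integrable (fun x : ℝ => x ^ α) ρ) {p : ℝ} (hp : 0 < p) :
    ∫⁻ z, ENNReal.ofReal (φ (p * z)) ∂(Measure.mconv ν ρ) =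
      ENNReal.ofReal (∫ x, ∫ y, φ (p * x * y) ∂ν ∂ρ) := by
  have hc := hφ.continuous
  have hm : Measurable fun z => ENNReal.ofReal (φ (p * z)) := by fun_prop
  rw [Measure.mconv_comm, Measure.lintegral_mconv hm,
    ofReal_integral_eq_lintegral_ofReal (hφ.integrable_integral_comp_mul hν hC hρ hint hp)
      (Eventually.of_forall fun x => hφ.integral_comp_mul_nonneg _)]
  refine lintegral_congr_ae ?_
  filter_upwards [hρ] with x hx
  rw [ofReal_integral_eq_lintegral_ofReal (hφ.integrable_comp_mul hν hC (mul_pos hp hx))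
    (Eventually.of_forall fun _ => hφ.nonneg _)]
  simp_rw [mul_assoc]

theorem exists_cutoff_tendsto :
    ∃ φ : ℕ → ℝ → ℝ, (∀ n, IsCutoff (φ n)) ∧
      ∀ y, Tendsto (fun n => φ n y) atTop (𝓝 ((Ici (1 : ℝ)).indicator (fun _ => 1) y)) := by
  -- The ramp starts at 1 - 1/(n + 2), which is at least 1/2 already for n = 0.
  refine ⟨fun n y => min 1 (max 0 (1 + (n + 2) * (y - 1))), fun n => ⟨by fun_prop, fun y => ?_,
    fun y => min_le_left _ _, fun y hy => ?_⟩, fun y => ?_⟩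
  · exact le_min zero_le_one (le_max_left _ _)
  · have : 1 + ((n : ℝ) + 2) * (y - 1) ≤ 0 := by nlinarith [n.cast_nonneg (α := ℝ)]
    beta_reduce
    rw [max_eq_left this, min_eq_right zero_le_one]
  · by_cases hy : y ∈ Ici (1 : ℝ)
    · rw [indicator_of_mem hy]
      refine tendsto_const_nhds.congr fun n => ?_
      have : 0 ≤ ((n : ℝ) + 2) * (y - 1) := mul_nonneg (by positivity) (sub_nonneg.2 hy)
      beta_reduce
      rw [max_eq_right (by linarith), min_eq_left (by linarith)]
    · rw [indicator_of_notMem hy]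
      rw [mem_Ici, not_le] at hy
      obtain ⟨N, hN⟩ := exists_nat_gt (1 / (1 - y))
      refine tendsto_const_nhds.congr' ?_
      filter_upwards [eventually_ge_atTop N] with n hn
      have h1 : 1 < (n : ℝ) * (1 - y) := by
        rw [div_lt_iff₀ (by linarith)] at hN
        have : (N : ℝ) ≤ n := by exact_mod_cast hn
        nlinarith
      rw [max_eq_left (by nlinarith), min_eq_right zero_le_one]

theorem HasTailBound.tendsto_integral_cutoff (hν : HasTailBound α C ν) (hC : C ≠ ∞)
    {φ : ℕ → ℝ → ℝ} (hφ : ∀ n, IsCutoff (φ n))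
    (hlim : ∀ y, Tendsto (fun n => φ n y) atTop (𝓝 ((Ici (1 : ℝ)).indicator (fun _ => 1) y)))
    {p : ℝ} (hp : 0 < p) :
    Tendsto (fun n => ∫ y, φ n (p⁻¹ * y) ∂ν) atTop (𝓝 (ν (Ici p)).toReal) := by
  have e : (ν (Ici p)).toReal = ∫ y, (Ici (1 : ℝ)).indicator (fun _ => (1 : ℝ)) (p⁻¹ * y) ∂ν := by
    have : (fun y => (Ici (1 : ℝ)).indicator (fun _ => (1 : ℝ)) (p⁻¹ * y)) =
        (Ici p).indicator fun _ => (1 : ℝ) := by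
      ext y
      have : 1 ≤ p⁻¹ * y ↔ p ≤ y := by
        rw [inv_mul_eq_div, one_le_div hp]
      simp [indicator_apply, this]
    rw [this, integral_indicator measurableSet_Ici]
    simp [Measure.real]
  rw [e]
  refine tendsto_integral_filter_of_dominated_convergence
    ((Ici (2 * p⁻¹)⁻¹).indicator fun _ => (1 : ℝ)) ?_ ?_
    (hν.integrable_indicator hC (by positivity)) (Eventually.of_forall fun y => hlim _)
  · exact Eventually.of_forall fun n => by
      have := (hφ n).continuous
      exact Continuous.aestronglyMeasurable (by fun_prop)
  · exact Eventually.of_forall fun n => Eventually.of_forall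
      ((hφ n).norm_comp_mul_le le_rfl (by positivity) (by positivity))

/-- A measure on `(0, ∞)` with finite tails is determined by them. -/
theorem HasTailBound.ext {ν' : Measure ℝ} (hν : HasTailBound α C ν) (hC : C ≠ ∞)
    (h0 : ν (Iic 0) = 0) (h0' : ν' (Iic 0) = 0) (h : ∀ p, 0 < p → ν (Ici p) = ν' (Ici p)) :
    ν = ν' := by
  have h1 : ν.restrict (Ioi 0) = ν'.restrict (Ioi 0) := by
    have hU : Ioi (0 : ℝ) = ⋃ n : ℕ, Ici (1 / ((n : ℝ) + 1)) := by
      ext x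
      simp only [mem_Ioi, mem_iUnion, mem_Ici]
      refine ⟨fun hx => ?_, fun ⟨n, hn⟩ => lt_of_lt_of_le (by positivity) hn⟩
      obtain ⟨n, hn⟩ := exists_nat_one_div_lt hx
      exact ⟨n, hn.le⟩
    rw [hU, Measure.restrict_iUnion_congr]
    intro n
    have hn : (0 : ℝ) < 1 / ((n : ℝ) + 1) := by positivity
    have : IsFiniteMeasure (ν.restrict (Ici (1 / ((n : ℝ) + 1)))) :=
      ⟨by rw [Measure.restrict_apply_univ]; exact hν.lt_top hC hn⟩
    refine Measure.ext_of_Ici _ _ fun a => ?_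
    rw [Measure.restrict_apply measurableSet_Ici, Measure.restrict_apply measurableSet_Ici,
      Ici_inter_Ici]
    exact h _ (lt_sup_of_lt_right hn)
  have h2 {μ : Measure ℝ} (hμ : μ (Iic 0) = 0) : μ.restrict (Ioi 0) = μ := by
    refine Measure.restrict_eq_self_of_ae_mem (measure_mono_null (fun x hx => ?_) hμ)
    simpa using hx
  rw [← h2 h0, ← h2 h0', h1]

end Cutoff

/-! ### Wiener's theorem in multiplicative form -/

theorem complexMoment_eq_integral_exp {α : ℝ} {ρ : Measure ℝ} (hρ : ∀ᵐ x ∂ρ, 0 < x) (θ : ℝ) :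
    complexMoment α θ ρ =
      ∫ x, Complex.exp ((θ * Real.log x : ℝ) * Complex.I) * ((x ^ α : ℝ) : ℂ) ∂ρ := by
  rw [complexMoment, Measure.restrict_eq_self_of_ae_mem (s := Ioi 0) hρ]
  refine integral_congr_ae ?_
  filter_upwards [hρ] with x hx
  have hx' : (x : ℂ) ≠ 0 := Complex.ofReal_ne_zero.2 hx.ne'
  rw [Complex.cpow_add _ _ hx', Complex.ofReal_cpow hx.le, mul_comm]
  congr 1
  rw [Complex.cpow_def_of_ne_zero hx', ← Complex.ofReal_log hx.le]
  push_cast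
  ring_nf

/-- Wiener's theorem in multiplicative form, for the signed measure `ρ + s • ρ'`. -/
theorem eq_zero_of_complexMoment_add_ne_zero {α B s : ℝ} {ρ ρ' : Measure ℝ} [SigmaFinite ρ]
    [SigmaFinite ρ'] (hρ : ∀ᵐ x ∂ρ, 0 < x) (hρ' : ∀ᵐ x ∂ρ', 0 < x)
    (hint : Integrable (fun x : ℝ => x ^ α) ρ) (hint' : Integrable (fun x : ℝ => x ^ α) ρ')
    (hne : ∀ θ : ℝ, complexMoment α θ ρ + s * complexMoment α θ ρ' ≠ 0)
    {D : ℝ → ℝ} (hDc : Continuous D) (hDb : ∀ u, |D u| ≤ B)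
    (hconv : ∀ u, ∫ x, D (u + Real.log x) * x ^ α ∂ρ +
      s * ∫ x, D (u + Real.log x) * x ^ α ∂ρ' = 0) (u : ℝ) : D u = 0 := by
  -- Two disjoint copies of the line keep `P` a positive measure; the sign `s` goes into the density
  -- `h`.
  let P : Measure (ℝ × Bool) := ρ.map (fun x => (x, true)) + ρ'.map (fun x => (x, false))
  let h : ℝ × Bool → ℂ := fun p => ((p.1 ^ α : ℝ) : ℂ) * if p.2 then 1 else (s : ℂ)
  have e (b : Bool) : MeasurableEmbedding fun x : ℝ => (x, b) := measurableEmbedding_prod_mk_right b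
  have h1 : Integrable h (ρ.map fun x => (x, true)) := by
    rw [(e true).integrable_map_iff]
    simpa [Function.comp_def, h] using hint.ofReal (𝕜 := ℂ)
  have h2 : Integrable h (ρ'.map fun x => (x, false)) := by
    rw [(e false).integrable_map_iff]
    simpa [Function.comp_def, h] using (hint'.ofReal (𝕜 := ℂ)).mul_const (s : ℂ)
  have key (F : ℝ → ℂ) (hF : Continuous F) (A : ℝ) (hA : ∀ t, ‖F t‖ ≤ A) :
      ∫ p, F (Real.log p.1) * h p ∂P = ∫ x, F (Real.log x) * ((x ^ α : ℝ) : ℂ) ∂ρ +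
        s * ∫ x, F (Real.log x) * ((x ^ α : ℝ) : ℂ) ∂ρ' := by
    have hm : Measurable fun p : ℝ × Bool => F (Real.log p.1) :=
      hF.measurable.comp (by fun_prop)
    rw [integral_add_measure (integrable_bounded_mul h1 hm.aestronglyMeasurable fun _ => hA _)
      (integrable_bounded_mul h2 hm.aestronglyMeasurable fun _ => hA _),
      (e true).integral_map, (e false).integral_map, ← integral_const_mul]
    congr 1
    · simp [h]
    · congr 1; ext x; simp [h]; ring
  have hres := eq_zero_of_forall_integral_add_mul_eq_zero (P := P)
    (Y := fun p => Real.log p.1) (h := h) (g := fun x => (D x : ℂ)) (B := B) (by fun_prop)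
    (h1.add_measure h2) (fun ξ => ?_) (by fun_prop) (fun x => ?_) (fun x => ?_) u
  · exact_mod_cast hres
  · rw [key (fun t => Complex.exp ((ξ * t : ℝ) * Complex.I)) (by fun_prop) 1
      (fun t => (Complex.norm_exp_ofReal_mul_I _).le), ← complexMoment_eq_integral_exp hρ,
      ← complexMoment_eq_integral_exp hρ']
    exact hne ξ
  · rw [Complex.norm_real]; exact hDb x
  · rw [key (fun t => (D (x + t) : ℂ)) (by fun_prop) B
      (fun t => by rw [Complex.norm_real]; exact hDb _)]
    simp_rw [← Complex.ofReal_mul]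
    rw [integral_complex_ofReal, integral_complex_ofReal]
    exact_mod_cast hconv x

/-! ### Decoupling the two equations -/

section Combination

variable {α : ℝ} {C C' : ℝ≥0∞} {ν ν' ρ ρ' : Measure ℝ} [SigmaFinite ν] [SigmaFinite ν']
  [SigmaFinite ρ] [SigmaFinite ρ'] {φ : ℝ → ℝ} {c c' K : ℝ}

theorem IsCutoff.integral_add_mul_integral_eq (hφ : IsCutoff φ)
    (hν : HasTailBound α C ν) (hC : C ≠ ∞) (hν' : HasTailBound α C' ν') (hC' : C' ≠ ∞)
    (hρ : ∀ᵐ x ∂ρ, 0 < x) (hρ' : ∀ᵐ x ∂ρ', 0 < x)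
    (hint : Integrable (fun x : ℝ => x ^ α) ρ) (hint' : Integrable (fun x : ℝ => x ^ α) ρ')
    (hE : ∀ p : ℝ, 0 < p → ∫ x, ∫ y, φ (p * x * y) ∂ν ∂ρ + ∫ x, ∫ y, φ (p * x * y) ∂ν' ∂ρ' =
      (c * ∫ x, x ^ α ∂ρ + c' * ∫ x, x ^ α ∂ρ') * (p ^ α * K))
    (hE' : ∀ p : ℝ, 0 < p → ∫ x, ∫ y, φ (p * x * y) ∂ν ∂ρ' + ∫ x, ∫ y, φ (p * x * y) ∂ν' ∂ρ =
      (c * ∫ x, x ^ α ∂ρ' + c' * ∫ x, x ^ α ∂ρ) * (p ^ α * K))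
    {s : ℝ} (hs : s ^ 2 = 1)
    (hne : ∀ θ : ℝ, complexMoment α θ ρ + s * complexMoment α θ ρ' ≠ 0) {p : ℝ} (hp : 0 < p) :
    ∫ y, φ (p * y) ∂ν + s * ∫ y, φ (p * y) ∂ν' = (c + s * c') * (p ^ α * K) := by
  set N : ℝ → ℝ := fun p => ∫ y, φ (p * y) ∂ν with hN
  set N' : ℝ → ℝ := fun p => ∫ y, φ (p * y) ∂ν' with hN'
  set D : ℝ → ℝ := fun u => Real.exp (-α * u) * (N (Real.exp u) + s * N' (Real.exp u)) -
    (c + s * c') * K with hD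
  have hexp (u : ℝ) : Real.exp (-α * u) * (Real.exp u) ^ α = 1 := by
    rw [← Real.exp_mul, ← Real.exp_add]
    simp [mul_comm]
  have hDc : Continuous D := by
    have h1 := hφ.continuous_integral_comp_exp_mul hν hC
    have h2 := hφ.continuous_integral_comp_exp_mul hν' hC'
    exact ((Continuous.mul (by fun_prop) (h1.add (h2.const_mul s)))).sub continuous_const
  have hG {μ : Measure ℝ} {A : ℝ≥0∞} (hμ : HasTailBound α A μ) (hA : A ≠ ∞) (u : ℝ) :
      |Real.exp (-α * u) * ∫ y, φ (Real.exp u * y) ∂μ| ≤ A.toReal * 2 ^ α := by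
    rw [abs_of_nonneg (mul_nonneg (Real.exp_pos _).le (hφ.integral_comp_mul_nonneg _))]
    calc _ ≤ Real.exp (-α * u) * (A.toReal * 2 ^ α * (Real.exp u) ^ α) :=
          mul_le_mul_of_nonneg_left (hφ.integral_comp_mul_le hμ hA (Real.exp_pos u))
            (Real.exp_pos _).le
      _ = A.toReal * 2 ^ α * (Real.exp (-α * u) * (Real.exp u) ^ α) := by ring
      _ = _ := by rw [hexp, mul_one]
  have hDb (u : ℝ) : |D u| ≤ C.toReal * 2 ^ α + |s| * (C'.toReal * 2 ^ α) +
      |(c + s * c') * K| := by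
    rw [hD]
    refine (abs_sub _ _).trans (add_le_add_left ?_ _)
    rw [mul_add, mul_left_comm]
    refine (abs_add_le _ _).trans (add_le_add (hG hν hC u) ?_)
    rw [abs_mul]
    exact mul_le_mul_of_nonneg_left (hG hν' hC' u) (abs_nonneg s)
  have hint_eq {μ : Measure ℝ} [SigmaFinite μ] (hμ : ∀ᵐ x ∂μ, 0 < x)
      (hi : Integrable (fun x : ℝ => x ^ α) μ) (u : ℝ) :
      ∫ x, D (u + Real.log x) * x ^ α ∂μ =
        Real.exp (-α * u) * (∫ x, N (Real.exp u * x) ∂μ + s * ∫ x, N' (Real.exp u * x) ∂μ) -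
          (c + s * c') * K * ∫ x, x ^ α ∂μ := by
    have i1 : Integrable (fun x => N (Real.exp u * x)) μ :=
      hφ.integrable_integral_comp_mul hν hC hμ hi (Real.exp_pos u)
    have i2 : Integrable (fun x => N' (Real.exp u * x)) μ :=
      hφ.integrable_integral_comp_mul hν' hC' hμ hi (Real.exp_pos u)
    have i3 : Integrable (fun x => N (Real.exp u * x) + s * N' (Real.exp u * x)) μ :=
      i1.add (i2.const_mul s)
    rw [← integral_const_mul, ← integral_const_mul, ← integral_add i1 (i2.const_mul s),
      ← integral_const_mul, ← integral_sub (i3.const_mul _) (hi.const_mul _)]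
    refine integral_congr_ae ?_
    filter_upwards [hμ] with x hx
    have h1 := hexp (Real.log x)
    rw [Real.exp_log hx] at h1
    simp only [hD]
    rw [Real.exp_add, Real.exp_log hx, mul_add (-α), Real.exp_add]
    linear_combination (Real.exp (-α * u) * (N (Real.exp u * x) + s * N' (Real.exp u * x))) * h1
  have hzero : D (Real.log p) = 0 := by
    refine eq_zero_of_complexMoment_add_ne_zero hρ hρ' hint hint' hne hDc hDb (fun u => ?_) _
    rw [hint_eq hρ hint, hint_eq hρ' hint']
    have h1 := hE _ (Real.exp_pos u)
    have h2 := hE' _ (Real.exp_pos u)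
    have h3 := hexp u
    have e1 : ∀ x, ∫ y, φ (Real.exp u * x * y) ∂ν = N (Real.exp u * x) := fun _ => rfl
    have e2 : ∀ x, ∫ y, φ (Real.exp u * x * y) ∂ν' = N' (Real.exp u * x) := fun _ => rfl
    simp_rw [e1, e2] at h1 h2
    -- Since s² = 1, the first equation plus `s` times the second is the convolution of N + sN' with
    -- ρ + sρ'; the right side factors likewise.
    linear_combination Real.exp (-α * u) * h1 + s * Real.exp (-α * u) * h2 +
      ((c * ∫ x, x ^ α ∂ρ + c' * ∫ x, x ^ α ∂ρ') * K +
        s * (c * ∫ x, x ^ α ∂ρ' + c' * ∫ x, x ^ α ∂ρ) * K) * h3 +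
      (Real.exp (-α * u) * ∫ x, N' (Real.exp u * x) ∂ρ' - c' * K * ∫ x, x ^ α ∂ρ') * hs
  have h1 := hexp (Real.log p)
  simp only [hD] at hzero
  rw [Real.exp_log hp] at h1 hzero
  linear_combination p ^ α * hzero - (N p + s * N' p) * h1

end Combination

/-! ### Proof of the theorem -/

/-- The index set `{1, -1}` is the group of units `ℤˣ`. Measures on `(0,∞)` and on `[0,∞)` are
Borel measures on `ℝ` giving zero mass to the complement. -/
theorem mainTheorem11 (α : ℝ) (hα : 0 < α)
    (ρ ν : ℤˣ → Measure ℝ) (c : ℤˣ → ℝ≥0)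
    (hρσ : ∀ i, SigmaFinite (ρ i)) (hνσ : ∀ i, SigmaFinite (ν i))
    (hρ : ∀ i, ρ i (Ioi 0)ᶜ = 0) (hν : ∀ i, ν i (Ici 0)ᶜ = 0)
    (hmom : ∀ i, absMoment α (ρ i) < ∞)
    (heq : ∀ i : ℤˣ,
      Measure.mconv (ν 1) (ρ i) + Measure.mconv (ν (-1)) (ρ (-i)) =
        ((c 1 : ℝ≥0∞) * absMoment α (ρ i) + (c (-1) : ℝ≥0∞) * absMoment α (ρ (-i))) •
          powerTail α)
    (hplus : ∀ θ : ℝ, complexMoment α θ (ρ 1) + complexMoment α θ (ρ (-1)) ≠ 0)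
    (hminus : ∀ θ : ℝ, complexMoment α θ (ρ 1) - complexMoment α θ (ρ (-1)) ≠ 0) :
    ∀ i : ℤˣ, ν i = (c i : ℝ≥0∞) • powerTail α := by
  have hpos (i : ℤˣ) : ∀ᵐ x ∂ρ i, 0 < x := hρ i
  have hCfin (i : ℤˣ) : (c 1 : ℝ≥0∞) * absMoment α (ρ i) +
      (c (-1) : ℝ≥0∞) * absMoment α (ρ (-i)) ≠ ∞ :=
    ENNReal.add_ne_top.2 ⟨ENNReal.mul_ne_top ENNReal.coe_ne_top (hmom _).ne,
      ENNReal.mul_ne_top ENNReal.coe_ne_top (hmom _).ne⟩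
  have hmeas : Measurable fun x : ℝ => x ^ α := by fun_prop
  have hmom_eq (i : ℤˣ) : absMoment α (ρ i) = ∫⁻ x, ENNReal.ofReal (x ^ α) ∂ρ i := by
    rw [absMoment, Measure.restrict_eq_self_of_ae_mem (s := Ioi 0) (hpos i)]
  have hnn (i : ℤˣ) : 0 ≤ᵐ[ρ i] fun x : ℝ => x ^ α := by
    filter_upwards [hpos i] with x hx using Real.rpow_nonneg hx.le _
  have hint (i : ℤˣ) : Integrable (fun x : ℝ => x ^ α) (ρ i) := by
    refine ⟨hmeas.aestronglyMeasurable, ?_⟩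
    rw [hasFiniteIntegral_iff_ofReal (hnn i), ← hmom_eq]
    exact hmom i
  have hmomR (i : ℤˣ) : absMoment α (ρ i) = ENNReal.ofReal (∫ x, x ^ α ∂ρ i) := by
    rw [hmom_eq, ofReal_integral_eq_lintegral_ofReal (hint i) (hnn i)]
  obtain ⟨j, hj⟩ : ∃ j, ρ j ≠ 0 := by
    by_contra! h
    exact hplus 0 (by simp [h, complexMoment])
  -- With `ρ j ≠ 0` fixed, equation `j` dominates `ν 1 ⊛ ρ j` and equation `-j` dominates `ν (-1) ⊛
  -- ρ j`.
  have hmconv (i : ℤˣ) : ∃ A : ℝ≥0∞, A ≠ ∞ ∧ Measure.mconv (ν i) (ρ j) ≤ A • powerTail α := by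
    rcases Int.units_eq_one_or i with rfl | rfl
    · exact ⟨_, hCfin j, (heq j) ▸ Measure.le_add_right le_rfl⟩
    · have := heq (-j)
      rw [neg_neg] at this
      have hf := hCfin (-j)
      rw [neg_neg] at hf
      exact ⟨_, hf, this ▸ Measure.le_add_left le_rfl⟩
  have hν0 (i : ℤˣ) : ν i (Iic 0) = 0 := by
    obtain ⟨A, -, hA⟩ := hmconv i
    refine measure_mono_null (fun x hx => ?_)
      (measure_union_null (hν i) (singleton_zero_null_of_mconv_le hj hA))
    rcases (mem_Iic.1 hx).lt_or_eq with h | h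
    · exact Or.inl (by simpa using h)
    · exact Or.inr h
  have htail (i : ℤˣ) : ∃ A ≠ ∞, HasTailBound α A (ν i) := by
    obtain ⟨A, hA, hle⟩ := hmconv i
    exact exists_hasTailBound_of_mconv_le hα (hρ j) hj hA hle
  choose A hA hAν using htail
  have hpt := hasTailBound_powerTail hα
  have hE (φ : ℝ → ℝ) (hφ : IsCutoff φ) (i : ℤˣ) (p : ℝ) (hp : 0 < p) :
      ∫ x, ∫ y, φ (p * x * y) ∂ν 1 ∂ρ i + ∫ x, ∫ y, φ (p * x * y) ∂ν (-1) ∂ρ (-i) =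
        (c 1 * ∫ x, x ^ α ∂ρ i + c (-1) * ∫ x, x ^ α ∂ρ (-i)) *
          (p ^ α * ∫ y, φ y ∂powerTail α) := by
    have h := congrArg (fun μ : Measure ℝ => ∫⁻ z, ENNReal.ofReal (φ (p * z)) ∂μ) (heq i)
    have hm (i : ℤˣ) : 0 ≤ ∫ x, x ^ α ∂ρ i := integral_nonneg_of_ae (hnn i)
    have hN (i j : ℤˣ) : 0 ≤ ∫ x, ∫ y, φ (p * x * y) ∂ν i ∂ρ j :=
      integral_nonneg fun _ => hφ.integral_comp_mul_nonneg _
    have hK : 0 ≤ p ^ α * ∫ y, φ y ∂powerTail α :=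
      mul_nonneg (Real.rpow_nonneg hp.le _) (integral_nonneg fun _ => hφ.nonneg _)
    simp only [lintegral_add_measure, lintegral_smul_measure, smul_eq_mul] at h
    rw [hφ.lintegral_mconv_eq (hAν 1) (hA 1) (hpos i) (hint i) hp,
      hφ.lintegral_mconv_eq (hAν (-1)) (hA (-1)) (hpos (-i)) (hint (-i)) hp,
      ← ofReal_integral_eq_lintegral_ofReal (hφ.integrable_comp_mul hpt ENNReal.one_ne_top hp)
        (Eventually.of_forall fun _ => hφ.nonneg _), integral_powerTail_comp_mul hα hp,
      hmomR, hmomR, ← ENNReal.ofReal_coe_nnreal, ← ENNReal.ofReal_coe_nnreal,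
      ← ENNReal.ofReal_mul (c 1).coe_nonneg, ← ENNReal.ofReal_mul (c (-1)).coe_nonneg,
      ← ENNReal.ofReal_add (hN _ _) (hN _ _),
      ← ENNReal.ofReal_add (mul_nonneg (c 1).coe_nonneg (hm _))
        (mul_nonneg (c (-1)).coe_nonneg (hm _)),
      ← ENNReal.ofReal_mul (add_nonneg (mul_nonneg (c 1).coe_nonneg (hm _))
        (mul_nonneg (c (-1)).coe_nonneg (hm _)))] at h
    rwa [ENNReal.ofReal_eq_ofReal_iff (add_nonneg (hN _ _) (hN _ _))
      (mul_nonneg (add_nonneg (mul_nonneg (c 1).coe_nonneg (hm _))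
        (mul_nonneg (c (-1)).coe_nonneg (hm _))) hK)] at h
  have hcut (φ : ℝ → ℝ) (hφ : IsCutoff φ) (i : ℤˣ) (p : ℝ) (hp : 0 < p) :
      ∫ y, φ (p * y) ∂ν i = c i * ∫ y, φ (p * y) ∂powerTail α := by
    -- The signs s = 1 and s = -1 use `hplus` and `hminus`; half the sum and half the difference
    -- isolate each `ν i`.
    have hcomb (s : ℝ) (hs : s ^ 2 = 1)
        (hne : ∀ θ : ℝ, complexMoment α θ (ρ 1) + s * complexMoment α θ (ρ (-1)) ≠ 0) :=
      hφ.integral_add_mul_integral_eq (hAν 1) (hA 1) (hAν (-1)) (hA (-1)) (hpos 1) (hpos (-1))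
        (hint 1) (hint (-1)) (hE φ hφ 1)
        (fun p hp => by simpa only [neg_neg] using hE φ hφ (-1) p hp) hs hne hp
    have h1 := hcomb 1 (by norm_num) (fun θ => by simpa using hplus θ)
    have h2 := hcomb (-1) (by norm_num) (fun θ => by simpa [sub_eq_add_neg] using hminus θ)
    rw [integral_powerTail_comp_mul hα hp]
    rcases Int.units_eq_one_or i with rfl | rfl <;> linarith
  intro i
  obtain ⟨φ, hφ, hlim⟩ := exists_cutoff_tendsto
  refine (hAν i).ext (hA i) (hν0 i) (by simp [powerTail_Iic_zero]) fun p hp => ?_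
  have h1 := (hAν i).tendsto_integral_cutoff (hA i) hφ hlim hp
  have h2 := (hpt.tendsto_integral_cutoff ENNReal.one_ne_top hφ hlim hp).const_mul (c i : ℝ)
  have h3 := tendsto_nhds_unique h1
    (h2.congr fun n => (hcut (φ n) (hφ n) i p⁻¹ (inv_pos.2 hp)).symm)
  rw [Measure.smul_apply, smul_eq_mul, ← ENNReal.toReal_eq_toReal_iff'
    ((hAν i).lt_top (hA i) hp).ne
    (ENNReal.mul_ne_top ENNReal.coe_ne_top (hpt.lt_top ENNReal.one_ne_top hp).ne),
    ENNReal.toReal_mul, h3]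
  simp
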